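/- Let $2^{<\omega}$ be the set of finite binary strings, with prefix order $\preceq$ and empty string $\varepsilon$, let $2^\omega$ be the set of infinite binary sequences, and let $\lambda$ be the uniform (fair coin) measure on $2^\omega$. For $X\in 2^\omega$, let $X{\upharpoonright}n$ be the string of its first $n$ bits. A Turing functional is a computably enumerable set $\Phi\subseteq 2^{<\omega}\times 2^{<\omega}$ such that whenever $(\sigma,\tau),(\sigma',\tau')\in\Phi$ and $\sigma\preceq\sigma'$, then $\tau\preceq\tau'$ or $\tau'\preceq\tau$. For $X\in2^\omega$, let $\Phi^X$ be the finite or infinite binary sequence that is the union of the (pairwise comparable) strings $\tau$ with $(X{\upharpoonright}n,\tau)\in\Phi$ for some $n$, with $\Phi^X=\varepsilon$ if there are none; when $\Phi^X$ is infinite, we say $X\in\mathrm{dom}(\Phi)$ and write $\Phi(X)=\Phi^X$. For $A\subseteq2^\omega$ put $\Phi(A)=\{\Phi(X):X\in A\cap\mathrm{dom}(\Phi)\}$. The semi-measure induced by $\Phi$ is the function $\lambda_\Phi:2^{<\omega}\to[0,1]$, $\lambda_\Phi(\tau)=\lambda(\{X\in2^\omega:\tau\preceq\Phi^X\})$. It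 is called computable if there is a computable function $f$ from $2^{<\omega}\times\mathbb{N}$ to the non-negative dyadic rationals such that $|\lambda_\Phi(\tau)-f(\tau,i)|\le2^{-i}$ for all $\tau\in 2^{<\omega}$ and $i\in\mathbb{N}$. Let $\mathsf{MLR}$ be the set of Martin-Löf random sequences with respect to $\lambda$, that is, of all $X\in2^\omega$ such that $X\notin\bigcap_i\mathcal U_i$ for every uniformly effectively open sequence $(\mathcal U_i)_{i\in\mathbb{N}}$ of subsets of $2^\omega$ with $\lambda(\mathcal U_i)\le2^{-i}$ for all $i$; here uniformly effectively open means that there are uniformly computably enumerable sets of strings $S_i\subseteq2^{<\omega}$ such that $\mathcal U_i$ is the set of all $X\in2^\omega$ with a prefix in $S_i$, for every $i$. **Theorem.** If $\Phi$ and $\Psi$ are Turing functionals such that $\lambda_\Phi=\lambda_\Psi$ and $\lambda_\Phi$ is computable, then $\Phi(\mathsf{MLR})=\Psi(\mathsf{MLR})$. -/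

import Mathlib

open scoped ENNReal

namespace CantorRandomness

/-- Infinite binary sequences. -/
abbrev Cantor : Type := ℕ → Bool

/-- Finite binary strings. The prefix order is `<+:`, the empty string is `[]`. -/
abbrev Str : Type := List Bool

/-- `X ↾ n`, the string of the first `n` bits of `X`. -/
def restrict (X : Cantor) (n : ℕ) : Str := (List.range n).map X

/-- The cylinder of all sequences that extend the string `σ`. -/
def cylinder (σ : Str) : Set Cantor := {X | restrict X σ.length = σ}

/-- The open set of all sequences that extend some string in `S`. -/
def openSet (S : Set Str) : Set Cantor := ⋃ σ ∈ S, cylinder σ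

/-- The uniform (Lebesgue) measure on Cantor space: the bits are independent and each of them
is `false` or `true` with probability `1/2`. -/
noncomputable def lebesgue : MeasureTheory.Measure Cantor :=
  MeasureTheory.Measure.infinitePi fun _ : ℕ => (PMF.uniformOfFintype Bool).toMeasure

/-- A uniformly computably enumerable sequence of sets of strings. -/
def UniformlyCE (S : ℕ → Set Str) : Prop :=
  REPred fun p : ℕ × Str => p.2 ∈ S p.1

/-- A uniformly effectively open sequence of subsets of Cantor space. -/
def UniformlyEffectivelyOpen (U : ℕ → Set Cantor) : Prop :=
  ∃ S : ℕ → Set Str, UniformlyCE S ∧ ∀ i, U i = openSet (S i)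

/-- A Martin-Löf test with respect to the uniform measure. -/
def IsMartinLofTest (U : ℕ → Set Cantor) : Prop :=
  UniformlyEffectivelyOpen U ∧ ∀ i, lebesgue (U i) ≤ (2⁻¹ : ℝ≥0∞) ^ i

/-- The set of Martin-Löf random sequences (with respect to the uniform measure). -/
def MLR : Set Cantor := {X | ∀ U : ℕ → Set Cantor, IsMartinLofTest U → X ∉ ⋂ i, U i}

/-- A Turing functional: a c.e. set of pairs of strings `(σ, τ)`, such that comparable
inputs have comparable outputs. -/
structure TuringFunctional where
  graph : Set (Str × Str)
  ce : REPred fun p : Str × Str => p ∈ graph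
  consistent : ∀ σ τ σ' τ' : Str, (σ, τ) ∈ graph → (σ', τ') ∈ graph → σ <+: σ' →
    τ <+: τ' ∨ τ' <+: τ

namespace TuringFunctional

/-- `Φ.Outputs X τ` says that `τ` is a prefix of `Φ^X`, where `Φ^X` is the finite or infinite
sequence that is the limit (the union) of all `τ'` such that `(X ↾ n, τ') ∈ Φ` for some `n`. If
there is no such `τ'`, then `Φ^X` is the empty string. -/
def Outputs (Φ : TuringFunctional) (X : Cantor) (τ : Str) : Prop :=
  τ = [] ∨ ∃ (n : ℕ) (τ' : Str), (restrict X n, τ') ∈ Φ.graph ∧ τ <+: τ'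

/-- `Φ.MapsTo X Y` says that `X ∈ dom Φ` and `Φ(X) = Y`: the output `Φ^X` is infinite and equal
to `Y`, that is, every finite initial segment of `Y` is a prefix of `Φ^X`. -/
def MapsTo (Φ : TuringFunctional) (X Y : Cantor) : Prop :=
  ∀ n : ℕ, Φ.Outputs X (restrict Y n)

/-- The image `Φ(A) = {Φ(X) : X ∈ A ∩ dom Φ}`. -/
def image (Φ : TuringFunctional) (A : Set Cantor) : Set Cantor :=
  {Y | ∃ X ∈ A, Φ.MapsTo X Y}

/-- The semi-measure `λ_Φ(τ) = λ {X : Φ^X ⪰ τ}` induced by `Φ`. -/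
noncomputable def semimeasure (Φ : TuringFunctional) (τ : Str) : ℝ :=
  (lebesgue {X | Φ.Outputs X τ}).toReal

end TuringFunctional

/-- A real-valued function `ρ` on strings is computable if some computable function gives, for
each string `σ` and each `i`, a non-negative dyadic rational `m / 2 ^ n` (presented by the pair
`(m, n)`) at distance at most `2 ^ (-i)` from `ρ σ`. -/
def IsComputableReal (ρ : Str → ℝ) : Prop :=
  ∃ f : Str × ℕ → ℕ × ℕ, Computable f ∧
    ∀ (σ : Str) (i : ℕ), |ρ σ - ((f (σ, i)).1 : ℝ) / 2 ^ (f (σ, i)).2| ≤ (1 / 2 : ℝ) ^ i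

end CantorRandomness

/-!
By symmetry it is enough to show `Φ(MLR) ⊆ Ψ(MLR)`. The idea is that the complement of `Ψ(MLR)` is
effectively null for the semi-measure `λ_Ψ`, in a sense that depends on the functional only through
the semi-measure.

Let `S i` be the levels of a universal Martin-Löf test (`exists_universal_test`). For each string
`τ`, the set `{X | Ψ^X ⪰ τ}` is effectively open, and its measure `λ_Ψ(τ)` is computable, so one can
compute a clopen subset `C_i(τ)` that misses only a tiny part of it
(`exists_computable_clopen_approx`). Add all the missed parts to `S (i + 1)`. The resulting effectively
open set `T i` is still small, and on its closed complement `{X | Ψ^X ⪰ τ}` coincides with the clopen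
set `C_i(τ)`, as it would if `Ψ` were total. If `Y ∉ Ψ(MLR)`, then no `X` outside `T i` lies in all
of `C_i(Y ↾ n)`, so by compactness `C_i(Y ↾ n) ⊆ T i` for some `n`. The set `W i` of all `τ` with
`C_i(τ) ⊆ T i` is recursively enumerable, again by compactness, and `{X | Ψ^X ⪰ τ} ⊆ T i` for
`τ ∈ W i`. So every `Y ∉ Ψ(MLR)` has an initial segment in every `W i`, while the preimage of `W i`
under `Ψ` is small (`exists_ce_cover_compl_image`).

By consistency, the measure of the preimage of `W i` is the sum of the semi-measure over the minimal
elements of `W i` (`lebesgue_biUnion_outputs`), so the preimage of `W i` under `Φ` is just as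
small. These preimages form a Martin-Löf test that catches every `X` with `Φ(X) = Y ∉ Ψ(MLR)`, so no
such `X` is random (`image_MLR_subset`).
-/

namespace CantorRandomness

open MeasureTheory

/-! ### Cylinders and open sets -/

@[simp] lemma length_restrict (X : Cantor) (n : ℕ) : (restrict X n).length = n := by
  simp [restrict]

lemma take_restrict (X : Cantor) (m n : ℕ) :
    (restrict X n).take m = restrict X (min m n) := by
  simp [restrict, ← List.map_take, List.take_range]

lemma restrict_prefix_restrict (X : Cantor) {m n : ℕ} (h : m ≤ n) :
    restrict X m <+: restrict X n := by
  rw [List.prefix_iff_eq_take, length_restrict, take_restrict, min_eq_left h]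

lemma prefix_restrict_iff {X : Cantor} {σ : Str} {n : ℕ} :
    σ <+: restrict X n ↔ σ.length ≤ n ∧ X ∈ cylinder σ := by
  constructor
  · intro h
    have hl : σ.length ≤ n := by simpa using h.length_le
    refine ⟨hl, ?_⟩
    rw [List.prefix_iff_eq_take, take_restrict, min_eq_left hl] at h
    exact h.symm
  · rintro ⟨hl, h⟩
    have h' : restrict X σ.length = σ := h
    rw [← h']
    exact restrict_prefix_restrict X hl

lemma mem_cylinder_restrict (X : Cantor) (n : ℕ) : X ∈ cylinder (restrict X n) := by
  simp [cylinder]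

lemma mem_openSet_iff {X : Cantor} {S : Set Str} : X ∈ openSet S ↔ ∃ σ ∈ S, X ∈ cylinder σ := by
  simp [openSet]

lemma openSet_mono {S T : Set Str} (h : S ⊆ T) : openSet S ⊆ openSet T :=
  Set.biUnion_subset_biUnion_left h

lemma openSet_setOf_exists {ι : Type*} (S : ι → Set Str) :
    openSet {σ | ∃ a, σ ∈ S a} = ⋃ a, openSet (S a) := by
  ext X
  simp only [mem_openSet_iff, Set.mem_ofPred_eq, Set.mem_iUnion]
  exact ⟨fun ⟨σ, ⟨a, h⟩, hX⟩ => ⟨a, σ, h, hX⟩, fun ⟨a, σ, h, hX⟩ => ⟨σ, ⟨a, h⟩, hX⟩⟩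

lemma cylinder_eq_pi (σ : Str) :
    cylinder σ = Set.pi (Finset.range σ.length) fun i => {σ.getD i false} := by
  ext X
  simp only [cylinder, Set.mem_ofPred_eq, Set.mem_pi, Finset.coe_range, Set.mem_Iio,
    Set.mem_singleton_iff]
  constructor
  · intro h i hi
    have := congrArg (fun l => l.getD i false) h
    simpa [restrict, hi] using this
  · intro h
    apply List.ext_getElem (by simp)
    intro i h1 h2
    have := h i h2
    simpa [restrict, h2] using this

lemma isClopen_cylinder (σ : Str) : IsClopen (cylinder σ) := by
  rw [cylinder_eq_pi]
  constructor
  · exact isClosed_set_pi fun i _ => isClosed_discrete _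
  · exact isOpen_set_pi (Finset.finite_toSet _) fun i _ => isOpen_discrete _

lemma measurableSet_cylinder (σ : Str) : MeasurableSet (cylinder σ) := by
  rw [cylinder_eq_pi]
  exact MeasurableSet.pi (Finset.countable_toSet _) fun i _ => measurableSet_singleton _

lemma isOpen_openSet (S : Set Str) : IsOpen (openSet S) :=
  isOpen_biUnion fun σ _ => (isClopen_cylinder σ).isOpen

lemma measurableSet_openSet (S : Set Str) : MeasurableSet (openSet S) :=
  MeasurableSet.biUnion S.to_countable fun σ _ => measurableSet_cylinder σ

lemma isClosed_openSet_list (L : List Str) : IsClosed (openSet {σ | σ ∈ L}) :=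
  L.finite_toSet.isClosed_biUnion fun σ _ => (isClopen_cylinder σ).isClosed

/-! ### The uniform measure of finite unions of cylinders -/

instance : IsProbabilityMeasure lebesgue := by
  unfold lebesgue; infer_instance

lemma lebesgue_cylinder (σ : Str) : lebesgue (cylinder σ) = (2⁻¹ : ℝ≥0∞) ^ σ.length := by
  rw [cylinder_eq_pi, lebesgue, Measure.infinitePi_pi _ fun i _ => measurableSet_singleton _]
  simp

/-- The list of all binary strings of length `m`. -/
def strs (m : ℕ) : List Str :=
  Nat.rec [[]] (fun _ l => l.map (List.cons false) ++ l.map (List.cons true)) m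

lemma strs_succ (m : ℕ) :
    strs (m + 1) = (strs m).map (List.cons false) ++ (strs m).map (List.cons true) := rfl

lemma mem_strs {m : ℕ} {σ : Str} : σ ∈ strs m ↔ σ.length = m := by
  induction m generalizing σ with
  | zero => simp [strs]
  | succ m ih =>
    rw [strs_succ]
    rcases σ with _ | ⟨_ | _, σ⟩ <;> simp [ih]

lemma nodup_strs (m : ℕ) : (strs m).Nodup := by
  induction m with
  | zero => simp [strs]
  | succ m ih =>
    rw [strs_succ]
    refine List.Nodup.append (ih.map (List.cons_injective)) (ih.map (List.cons_injective)) ?_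
    intro σ h1 h2
    simp only [List.mem_map] at h1 h2
    obtain ⟨a, -, rfl⟩ := h1
    obtain ⟨b, -, hb⟩ := h2
    simp at hb

/-- The number of strings of length `m` that extend some string in the list `L`. -/
def countExt (L : List Str) (m : ℕ) : ℕ :=
  ((strs m).filter fun ρ => ∃ σ ∈ L, σ <+: ρ).length

lemma lebesgue_openSet_list (L : List Str) {m : ℕ} (hm : ∀ σ ∈ L, σ.length ≤ m) :
    lebesgue (openSet {σ | σ ∈ L}) = countExt L m * (2⁻¹ : ℝ≥0∞) ^ m := by
  have hset : openSet {σ | σ ∈ L} =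
      ⋃ ρ ∈ ((strs m).filter fun ρ => ∃ σ ∈ L, σ <+: ρ).toFinset, cylinder ρ := by
    ext X
    simp only [mem_openSet_iff, Set.mem_ofPred_eq, Set.mem_iUnion, List.mem_toFinset,
      List.mem_filter, decide_eq_true_eq, mem_strs, exists_prop]
    constructor
    · rintro ⟨σ, hσ, hX⟩
      exact ⟨restrict X m, ⟨by simp, σ, hσ, prefix_restrict_iff.2 ⟨hm σ hσ, hX⟩⟩,
        mem_cylinder_restrict X m⟩
    · rintro ⟨ρ, ⟨hρ, σ, hσ, hp⟩, hX⟩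
      have hX' : restrict X ρ.length = ρ := hX
      rw [← hX', prefix_restrict_iff] at hp
      exact ⟨σ, hσ, hp.2⟩
  rw [hset, measure_biUnion_finset]
  · rw [Finset.sum_congr rfl (g := fun _ => (2⁻¹ : ℝ≥0∞) ^ m), Finset.sum_const,
      List.toFinset_card_of_nodup ((nodup_strs m).filter _), nsmul_eq_mul]
    · rfl
    · intro ρ hρ
      simp only [List.mem_toFinset, List.mem_filter, mem_strs] at hρ
      rw [lebesgue_cylinder, hρ.1]
  · intro ρ hρ ρ' hρ' hne
    simp only [Finset.mem_coe, List.mem_toFinset, List.mem_filter, mem_strs] at hρ hρ'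
    refine Set.disjoint_left.2 fun X hX hX' => hne ?_
    have h1 : restrict X ρ.length = ρ := hX
    have h2 : restrict X ρ'.length = ρ' := hX'
    rw [← h1, ← h2, hρ.1, hρ'.1]
  · exact fun ρ _ => measurableSet_cylinder ρ

lemma length_le_length_flatten {α : Type*} {L : List (List α)} {l : List α} (h : l ∈ L) :
    l.length ≤ L.flatten.length := by
  rw [List.length_flatten]
  exact List.single_le_sum (by simp) _ (List.mem_map_of_mem h)

/-- The level `L.flatten.length` is a convenient primitive recursive bound for the lengths of the
strings in `L`. -/
lemma lebesgue_openSet_list_real (L : List Str) :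
    lebesgue.real (openSet {σ | σ ∈ L}) =
      countExt L L.flatten.length / 2 ^ L.flatten.length := by
  rw [measureReal_def, lebesgue_openSet_list L fun σ h => length_le_length_flatten h]
  simp [div_eq_mul_inv]

/-- If `m` is smaller than some lengths in `L`, the strings of length `m` that are merely compatible
with elements of `L` still cover the clopen set; so no bound on `m` is needed. -/
lemma openSet_subset_of_forall_strs {L : List Str} {T : Set Str} {m : ℕ}
    (h : ∀ ρ ∈ strs m, (∃ σ ∈ L, σ <+: ρ ∨ ρ <+: σ) → ∃ σ ∈ T, σ <+: ρ) :
    openSet {σ | σ ∈ L} ⊆ openSet T := by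
  intro X hX
  obtain ⟨σ, hσ, hX⟩ := mem_openSet_iff.1 hX
  obtain ⟨η, hη, hp⟩ := h (restrict X m) (by simp [mem_strs]) ⟨σ, hσ, by
    have hX' : restrict X σ.length = σ := hX
    rw [← hX']
    rcases le_total σ.length m with hl | hl
    · exact .inl (restrict_prefix_restrict X hl)
    · exact .inr (restrict_prefix_restrict X hl)⟩
  exact mem_openSet_iff.2 ⟨η, hη, (prefix_restrict_iff.1 hp).2⟩

/-- By compactness, an inclusion of a clopen set into an open set is witnessed at a finite
level `m`. -/
lemma exists_forall_strs_of_openSet_subset {L : List Str} {T : Set Str}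
    (h : openSet {σ | σ ∈ L} ⊆ openSet T) :
    ∃ m, ∀ ρ ∈ strs m, (∃ σ ∈ L, σ <+: ρ ∨ ρ <+: σ) → ∃ σ ∈ T, σ <+: ρ := by
  have hK : IsCompact (openSet {σ | σ ∈ L}) := (isClosed_openSet_list L).isCompact
  have hdir : Directed (· ⊆ ·) fun m : ℕ => openSet {σ | σ ∈ T ∧ σ.length ≤ m} :=
    Monotone.directed_le fun m n hmn => openSet_mono fun σ hσ => ⟨hσ.1, hσ.2.trans hmn⟩
  obtain ⟨m, hm⟩ := hK.elim_directed_cover _ (fun m => isOpen_openSet _)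
    (fun X hX => by
      obtain ⟨σ, hσ, hX⟩ := mem_openSet_iff.1 (h hX)
      exact Set.mem_iUnion.2 ⟨σ.length, mem_openSet_iff.2 ⟨σ, ⟨hσ, le_rfl⟩, hX⟩⟩) hdir
  refine ⟨m + L.flatten.length, fun ρ hρ ⟨σ, hσ, hc⟩ => ?_⟩
  rw [mem_strs] at hρ
  have hσl := length_le_length_flatten hσ
  have hp : σ <+: ρ := by
    rcases hc with hc | hc
    · exact hc
    · exact (hc.eq_of_length_le (by omega)).symm ▸ List.prefix_rfl
  -- Any sequence through `ρ` will do.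
  obtain ⟨X, hX⟩ : ∃ X : Cantor, restrict X ρ.length = ρ :=
    ⟨fun i => ρ.getD i false, by
      apply List.ext_getElem (by simp)
      intro i h1 h2
      simp [restrict, h2]⟩
  rw [← hX, prefix_restrict_iff] at hp
  obtain ⟨η, ⟨hη, hl⟩, hXη⟩ := mem_openSet_iff.1 (hm (mem_openSet_iff.2 ⟨σ, hσ, hp.2⟩))
  refine ⟨η, hη, ?_⟩
  rw [← hX, prefix_restrict_iff]
  exact ⟨by omega, hXη⟩

/-- The open set generated by `S`, minus a finite union of cylinders, as an open set. -/
lemma openSet_diff_list (S : Set Str) (L : List Str) :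
    openSet {ρ | (∃ σ ∈ S, σ <+: ρ) ∧ ∀ η ∈ L, ¬ (η <+: ρ ∨ ρ <+: η)} =
      openSet S \ openSet {σ | σ ∈ L} := by
  ext X
  simp only [Set.mem_sdiff, mem_openSet_iff, Set.mem_ofPred_eq]
  constructor
  · rintro ⟨ρ, ⟨⟨σ, hσ, hp⟩, hn⟩, hX⟩
    have hX' : restrict X ρ.length = ρ := hX
    refine ⟨⟨σ, hσ, ?_⟩, ?_⟩
    · rw [← hX', prefix_restrict_iff] at hp
      exact hp.2
    · rintro ⟨η, hη, hXη⟩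
      have hη' : restrict X η.length = η := hXη
      refine hn η hη ?_
      rw [← hX', ← hη']
      rcases le_total η.length ρ.length with hl | hl
      · exact .inl (restrict_prefix_restrict X hl)
      · exact .inr (restrict_prefix_restrict X hl)
  · rintro ⟨⟨σ, hσ, hX⟩, hn⟩
    refine ⟨restrict X (σ.length + L.flatten.length), ⟨⟨σ, hσ, ?_⟩, ?_⟩,
      mem_cylinder_restrict X _⟩
    · exact prefix_restrict_iff.2 ⟨by omega, hX⟩
    · intro η hη hc
      have hl := length_le_length_flatten hη
      refine hn ⟨η, hη, ?_⟩
      rcases hc with hc | hc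
      · exact (prefix_restrict_iff.1 hc).2
      · have := hc.eq_of_length_le (by rw [length_restrict]; omega)
        rw [← this]
        exact mem_cylinder_restrict X _

end CantorRandomness

/-! ### Closure properties of recursively enumerable predicates -/

section REPred

variable {α β : Type*} [Primcodable α] [Primcodable β]

/-- A recursively enumerable predicate is the projection of a primitive recursive relation that
is monotone in the projected argument, the number of steps of a computation. -/
lemma REPred.exists_primrecRel {p : α → Prop} (hp : REPred p) :
    ∃ R : α → ℕ → Prop, PrimrecRel R ∧ (∀ a m n, m ≤ n → R a m → R a n) ∧
      ∀ a, p a ↔ ∃ n, R a n := by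
  obtain ⟨c, hc⟩ := Nat.Partrec.Code.exists_code.1 hp
  refine ⟨fun a n => (Nat.Partrec.Code.evaln n c (Encodable.encode a)).isSome = true, ?_, ?_, ?_⟩
  · have h := Primrec.option_isSome.comp (Nat.Partrec.Code.primrec_evaln.comp
      (((Primrec.snd (α := α) (β := ℕ)).pair (Primrec.const c)).pair
        (Primrec.encode.comp Primrec.fst)))
    exact Primrec.eq.comp h (Primrec.const true)
  · intro a m n hmn h
    obtain ⟨x, hx⟩ := Option.isSome_iff_exists.1 h
    exact Option.isSome_iff_exists.2 ⟨x, Nat.Partrec.Code.evaln_mono hmn hx⟩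
  · intro a
    have h1 : p a ↔ (Nat.Partrec.Code.eval c (Encodable.encode a)).Dom := by
      rw [hc]
      simp [Part.assert]
    rw [h1, Part.dom_iff_mem]
    simp only [Nat.Partrec.Code.evaln_complete, Option.isSome_iff_exists]
    exact exists_comm

lemma REPred.comp {p : β → Prop} (hp : REPred p) {f : α → β} (hf : Computable f) :
    REPred fun a => p (f a) :=
  Partrec.comp hp hf

lemma ComputablePred.exists_nat_re {p : α × ℕ → Prop} (hp : ComputablePred p) :
    REPred fun a => ∃ n, p (a, n) := by
  obtain ⟨f, hf, rfl⟩ := ComputablePred.computable_iff.1 hp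
  have h : Partrec fun a => Nat.rfind fun n => Part.some (f (a, n)) :=
    Partrec.rfind (p := fun a n => Part.some (f (a, n))) hf.partrec
  refine h.dom_re.of_eq fun a => ?_
  refine Nat.rfind_dom'.trans ?_
  simp

lemma PrimrecPred.computablePred_comp {p : β → Prop} (hp : PrimrecPred p) {f : α → β}
    (hf : Computable f) : ComputablePred fun a => p (f a) := by
  obtain ⟨d, hd⟩ := hp
  exact ⟨fun a => d (f a), hd.to_comp.comp hf⟩

lemma PrimrecPred.to_re {p : α → Prop} (hp : PrimrecPred p) : REPred p :=
  hp.computablePred.to_re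

lemma REPred.exists {p : α × β → Prop} (hp : REPred p) : REPred fun a => ∃ b, p (a, b) := by
  obtain ⟨R, hR, -, hpR⟩ := hp.exists_primrecRel
  have h : PrimrecPred fun q : α × ℕ =>
      ∃ b ∈ (Encodable.decode (α := β) q.2.unpair.1).toList, R (q.1, b) q.2.unpair.2 := by
    have h1 : PrimrecRel fun (b : β) (q : α × ℕ) => R (q.1, b) q.2.unpair.2 :=
      hR.comp ((Primrec.fst.comp Primrec.snd).pair Primrec.fst)
        (Primrec.snd.comp (Primrec.unpair.comp (Primrec.snd.comp Primrec.snd)))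
    have h2 : Primrec fun q : α × ℕ => (Encodable.decode (α := β) q.2.unpair.1).toList :=
      (Primrec.option_casesOn (o := fun q : α × ℕ => Encodable.decode (α := β) q.2.unpair.1)
        (Primrec.decode.comp (Primrec.fst.comp (Primrec.unpair.comp Primrec.snd)))
        (Primrec.const [])
        (Primrec.list_cons.comp Primrec.snd (Primrec.const [])).to₂).of_eq fun q => by
          cases Encodable.decode (α := β) q.2.unpair.1 <;> rfl
    exact h1.exists_mem_list.comp h2 Primrec.id
  refine (ComputablePred.exists_nat_re h.computablePred).of_eq fun a => ?_
  simp only [Option.mem_toList, hpR]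
  constructor
  · rintro ⟨n, b, -, h⟩
    exact ⟨b, _, h⟩
  · rintro ⟨b, n, h⟩
    exact ⟨Nat.pair (Encodable.encode b) n, b, by simp, by simpa using h⟩

lemma REPred.and {p q : α → Prop} (hp : REPred p) (hq : REPred q) :
    REPred fun a => p a ∧ q a := by
  refine (Partrec.bind hp (Partrec.comp hq Computable.fst).to₂).dom_re.of_eq fun a => ?_
  simp [Part.assert]

lemma REPred.or {p q : α → Prop} (hp : REPred p) (hq : REPred q) :
    REPred fun a => p a ∨ q a := by
  obtain ⟨R, hR, -, hpR⟩ := hp.exists_primrecRel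
  obtain ⟨R', hR', -, hqR⟩ := hq.exists_primrecRel
  refine (ComputablePred.exists_nat_re (p := fun a => R a.1 a.2 ∨ R' a.1 a.2)
    (PrimrecPred.or hR hR').computablePred).of_eq fun a => ?_
  rw [hpR, hqR, exists_or]

lemma REPred.forall_mem_list {p : α × β → Prop} (hp : REPred p) :
    REPred fun q : α × List β => ∀ b ∈ q.2, p (q.1, b) := by
  obtain ⟨R, hR, hmono, hpR⟩ := hp.exists_primrecRel
  have h1 : PrimrecRel fun (b : β) (q : (α × List β) × ℕ) => R (q.1.1, b) q.2 :=
    hR.comp ((Primrec.fst.comp (Primrec.fst.comp Primrec.snd)).pair Primrec.fst)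
      (Primrec.snd.comp Primrec.snd)
  have h2 : PrimrecPred fun q : (α × List β) × ℕ => ∀ b ∈ q.1.2, R (q.1.1, b) q.2 :=
    h1.forall_mem_list.comp (Primrec.snd.comp Primrec.fst) Primrec.id
  refine (ComputablePred.exists_nat_re h2.computablePred).of_eq fun ⟨a, l⟩ => ?_
  simp only [hpR]
  constructor
  · rintro ⟨n, h⟩ b hb
    exact ⟨n, h b hb⟩
  · intro h
    induction l with
    | nil => exact ⟨0, by simp⟩
    | cons b l ih =>
      obtain ⟨n, hn⟩ := ih fun b hb => h b (List.mem_cons_of_mem _ hb)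
      obtain ⟨m, hm⟩ := h b List.mem_cons_self
      refine ⟨max m n, fun b' hb' => ?_⟩
      rcases List.mem_cons.1 hb' with rfl | hb'
      · exact hmono _ _ _ (le_max_left _ _) hm
      · exact hmono _ _ _ (le_max_right _ _) (hn b' hb')

/-- Uniformly recursively enumerable sets are the unions of increasing sequences of finite lists,
uniformly given by a primitive recursive function. -/
lemma REPred.exists_stages {p : α × β → Prop} (hp : REPred p) :
    ∃ g : α → ℕ → List β, Primrec₂ g ∧ (∀ a m n, m ≤ n → g a m ⊆ g a n) ∧
      ∀ a b, p (a, b) ↔ ∃ n, b ∈ g a n := by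
  classical
  obtain ⟨R, hR, hmono, hpR⟩ := hp.exists_primrecRel
  refine ⟨fun a n => (List.range n).filterMap fun k =>
    (Encodable.decode (α := β) k).bind fun b => if R (a, b) n then some b else none, ?_, ?_, ?_⟩
  · refine Primrec.listFilterMap (Primrec.list_range.comp Primrec.snd) ?_
    refine Primrec.option_bind (Primrec.decode.comp Primrec.snd) ?_
    refine Primrec.ite (hR.comp ?_ ?_) (Primrec.option_some.comp Primrec.snd) (Primrec.const none)
    · exact (Primrec.fst.comp (Primrec.fst.comp Primrec.fst)).pair Primrec.snd
    · exact Primrec.snd.comp (Primrec.fst.comp Primrec.fst)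
  · intro a m n hmn b hb
    simp only [List.mem_filterMap, List.mem_range, Option.bind_eq_some_iff,
      Option.ite_none_right_eq_some, Option.some.injEq] at hb ⊢
    obtain ⟨k, hk, b', hb', hR', rfl⟩ := hb
    exact ⟨k, hk.trans_le hmn, b', hb', hmono _ _ _ hmn hR', rfl⟩
  · intro a b
    simp only [List.mem_filterMap, List.mem_range, Option.bind_eq_some_iff,
      Option.ite_none_right_eq_some, Option.some.injEq, hpR]
    constructor
    · rintro ⟨n, hn⟩
      exact ⟨max n (Encodable.encode b + 1), Encodable.encode b, by omega, b, by simp,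
        hmono _ _ _ (le_max_left _ _) hn, rfl⟩
    · rintro ⟨n, k, -, b', -, h, rfl⟩
      exact ⟨n, h⟩

end REPred

namespace CantorRandomness

open MeasureTheory

/-! ### Computing the measure of finite unions of cylinders -/

lemma primrec_two_pow : Primrec fun n : ℕ => 2 ^ n :=
  (Primrec₂.unpaired'.1 Nat.Primrec.pow).comp (Primrec.const 2) Primrec.id

lemma primrecRel_prefix : PrimrecRel fun σ τ : Str => σ <+: τ :=
  PrimrecPred.of_eq (Primrec.eq.comp Primrec.fst
    (Primrec.list_take.comp (Primrec.list_length.comp Primrec.fst) Primrec.snd))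
    fun _ => List.prefix_iff_eq_take.symm

lemma primrecRel_compatible : PrimrecRel fun σ τ : Str => σ <+: τ ∨ τ <+: σ :=
  PrimrecPred.or primrecRel_prefix (primrecRel_prefix.comp Primrec.snd Primrec.fst)

lemma primrec_strs : Primrec strs := by
  refine Primrec.nat_rec₁ _ ?_
  exact Primrec.list_append.comp
    (Primrec.list_map Primrec.snd (Primrec.list_cons.comp (Primrec.const false) Primrec.snd).to₂)
    (Primrec.list_map Primrec.snd (Primrec.list_cons.comp (Primrec.const true) Primrec.snd).to₂)

lemma primrec_countExt : Primrec₂ countExt := by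
  have h1 : PrimrecRel fun (σ : Str) (ρ : Str) => σ <+: ρ := primrecRel_prefix
  have h2 : PrimrecRel fun (ρ : Str) (L : List Str) => ∃ σ ∈ L, σ <+: ρ :=
    h1.exists_mem_list.comp Primrec.snd Primrec.fst
  exact Primrec.list_length.comp
    (h2.listFilter.comp (primrec_strs.comp Primrec.snd) Primrec.fst)

/-- The comparison of a finite union of cylinders with a dyadic rational of the form
`(m / 2 ^ n - 2 / 2 ^ k)` is decidable. -/
lemma primrecPred_le_lebesgue_openSet : PrimrecPred fun q : List Str × ℕ × ℕ × ℕ =>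
    (q.2.1 : ℝ) / 2 ^ q.2.2.1 ≤ lebesgue.real (openSet {σ | σ ∈ q.1}) + 2 / 2 ^ q.2.2.2 := by
  have hL : Primrec fun q : List Str × ℕ × ℕ × ℕ => q.1 := Primrec.fst
  have hm : Primrec fun q : List Str × ℕ × ℕ × ℕ => q.2.1 := Primrec.fst.comp Primrec.snd
  have hn : Primrec fun q : List Str × ℕ × ℕ × ℕ => 2 ^ q.2.2.1 :=
    primrec_two_pow.comp (Primrec.fst.comp (Primrec.snd.comp Primrec.snd))
  have hk : Primrec fun q : List Str × ℕ × ℕ × ℕ => 2 ^ q.2.2.2 :=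
    primrec_two_pow.comp (Primrec.snd.comp (Primrec.snd.comp Primrec.snd))
  have hl : Primrec fun q : List Str × ℕ × ℕ × ℕ => q.1.flatten.length :=
    Primrec.list_length.comp (Primrec.list_flatten.comp hL)
  have hM := primrec_two_pow.comp hl
  have hc := primrec_countExt.comp hL hl
  refine (Primrec.nat_le.comp (Primrec.nat_mul.comp hm (Primrec.nat_mul.comp hM hk))
    (Primrec.nat_add.comp (Primrec.nat_mul.comp hc (Primrec.nat_mul.comp hn hk))
      (Primrec.nat_mul.comp (Primrec.const 2) (Primrec.nat_mul.comp hn hM)))).of_eq ?_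
  rintro ⟨L, m, n, k⟩
  rw [lebesgue_openSet_list_real]
  set M := L.flatten.length
  set c := countExt L M
  have h1 : (m : ℝ) / 2 ^ n = (m * (2 ^ M * 2 ^ k)) / (2 ^ n * 2 ^ M * 2 ^ k) := by field_simp
  have h2 : (c : ℝ) / 2 ^ M + 2 / 2 ^ k =
      (c * (2 ^ n * 2 ^ k) + 2 * (2 ^ n * 2 ^ M)) / (2 ^ n * 2 ^ M * 2 ^ k) := by field_simp
  rw [h1, h2, div_le_div_iff_of_pos_right (by positivity)]
  exact_mod_cast Iff.rfl

lemma primrecRel_lebesgue_openSet_le : PrimrecRel fun (L : List Str) (i : ℕ) =>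
    lebesgue (openSet {σ | σ ∈ L}) ≤ (2⁻¹ : ℝ≥0∞) ^ i := by
  have hl : Primrec fun q : List Str × ℕ => q.1.flatten.length :=
    Primrec.list_length.comp (Primrec.list_flatten.comp Primrec.fst)
  refine (Primrec.nat_le.comp (Primrec.nat_mul.comp (primrec_countExt.comp Primrec.fst hl)
    (primrec_two_pow.comp Primrec.snd)) (primrec_two_pow.comp hl)).of_eq ?_
  rintro ⟨L, i⟩
  have h : lebesgue (openSet {σ | σ ∈ L}) ≤ (2⁻¹ : ℝ≥0∞) ^ i ↔
      lebesgue.real (openSet {σ | σ ∈ L}) ≤ (2⁻¹ : ℝ) ^ i := by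
    rw [measureReal_def, ← ENNReal.toReal_le_toReal (measure_ne_top _ _) (by simp)]
    simp
  simp only [h, lebesgue_openSet_list_real, inv_pow]
  rw [div_le_iff₀ (by positivity), inv_mul_eq_div, le_div_iff₀ (by positivity)]
  exact_mod_cast Iff.rfl

/-! ### A universal Martin-Löf test -/

lemma tsum_inv_two_pow_add_succ (i : ℕ) :
    ∑' e : ℕ, (2⁻¹ : ℝ≥0∞) ^ (i + e + 1) = 2⁻¹ ^ i := by
  have h : ∀ e : ℕ, (2⁻¹ : ℝ≥0∞) ^ (i + e + 1) = 2⁻¹ ^ i * 2⁻¹ * 2⁻¹ ^ e := fun e => by ring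
  simp_rw [h]
  rw [ENNReal.tsum_mul_left, ENNReal.tsum_geometric, ENNReal.one_sub_inv_two, inv_inv, mul_assoc,
    ENNReal.inv_mul_cancel (by simp) (by simp), mul_one]

/-- An enumeration that is cut off as soon as its measure exceeds `r` gives an open set of measure
at most `r`. -/
lemma lebesgue_truncation_le {g : ℕ → List Str} (hg : ∀ m n, m ≤ n → g m ⊆ g n) (r : ℝ≥0∞) :
    lebesgue (openSet {σ | ∃ n, σ ∈ g n ∧ lebesgue (openSet {σ | σ ∈ g n}) ≤ r}) ≤ r := by
  have h : openSet {σ | ∃ n, σ ∈ g n ∧ lebesgue (openSet {σ | σ ∈ g n}) ≤ r} =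
      ⋃ n ∈ {n | lebesgue (openSet {σ | σ ∈ g n}) ≤ r}, openSet {σ | σ ∈ g n} := by
    ext X
    simp only [mem_openSet_iff, Set.mem_ofPred_eq, Set.mem_iUnion, exists_prop]
    exact ⟨fun ⟨σ, ⟨n, h1, h2⟩, h3⟩ => ⟨n, h2, σ, h1, h3⟩,
      fun ⟨n, h2, σ, h1, h3⟩ => ⟨σ, ⟨n, h1, h2⟩, h3⟩⟩
  rw [h, measure_biUnion_eq_iSup (Set.to_countable _)]
  · exact iSup₂_le fun n hn => hn
  · intro m hm n hn
    refine ⟨max m n, ?_, openSet_mono (hg _ _ (le_max_left _ _)),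
      openSet_mono (hg _ _ (le_max_right _ _))⟩
    rcases max_choice m n with h | h <;> rw [h] <;> assumption

/-- The sum of all tests, each of them given by a code for a partial recursive function and cut off
at the measure that is allowed for it. -/
lemma exists_universal_test : ∃ S : ℕ → Set Str, UniformlyCE S ∧
    (∀ i, lebesgue (openSet (S i)) ≤ (2⁻¹ : ℝ≥0∞) ^ i) ∧ ∀ X i, X ∉ openSet (S i) → X ∈ MLR := by
  let p : (ℕ × ℕ) × Str → Prop := fun q =>
    (Nat.Partrec.Code.eval (Denumerable.ofNat Nat.Partrec.Code q.1.1)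
      (Encodable.encode (q.1.2, q.2))).Dom
  have hp : REPred p := by
    refine (Nat.Partrec.Code.eval_part.comp ?_ ?_).dom_re
    · exact (Computable.ofNat _).comp (Computable.fst.comp Computable.fst)
    · exact Computable.encode.comp ((Computable.snd.comp Computable.fst).pair Computable.snd)
  obtain ⟨g, hg, hmono, hpg⟩ := hp.exists_stages
  refine ⟨fun i => {σ | ∃ e : ℕ, σ ∈ {σ | ∃ n, σ ∈ g (e, i + e + 1) n ∧
    lebesgue (openSet {σ | σ ∈ g (e, i + e + 1) n}) ≤ (2⁻¹ : ℝ≥0∞) ^ (i + e + 1)}}, ?_, ?_, ?_⟩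
  · have hi : Primrec fun q : ((ℕ × Str) × ℕ) × ℕ => q.1.1.1 + q.1.2 + 1 :=
      Primrec.succ.comp (Primrec.nat_add.comp
        (Primrec.fst.comp (Primrec.fst.comp Primrec.fst)) (Primrec.snd.comp Primrec.fst))
    have hG : Primrec fun q : ((ℕ × Str) × ℕ) × ℕ => g (q.1.2, q.1.1.1 + q.1.2 + 1) q.2 :=
      hg.comp ((Primrec.snd.comp Primrec.fst).pair hi) Primrec.snd
    have h : PrimrecPred fun q : ((ℕ × Str) × ℕ) × ℕ =>
        q.1.1.2 ∈ g (q.1.2, q.1.1.1 + q.1.2 + 1) q.2 ∧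
        lebesgue (openSet {σ | σ ∈ g (q.1.2, q.1.1.1 + q.1.2 + 1) q.2}) ≤
          (2⁻¹ : ℝ≥0∞) ^ (q.1.1.1 + q.1.2 + 1) := by
      refine PrimrecPred.and ?_ (primrecRel_lebesgue_openSet_le.comp hG hi)
      have hmem : PrimrecRel fun (l : List Str) (τ : Str) => ∃ σ ∈ l, σ = τ :=
        PrimrecRel.exists_mem_list Primrec.eq
      exact (hmem.comp hG (Primrec.snd.comp (Primrec.fst.comp Primrec.fst))).of_eq fun q => by
        simp
    exact h.to_re.exists.exists
  · intro i
    rw [openSet_setOf_exists]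
    refine (measure_iUnion_le _).trans ?_
    rw [← tsum_inv_two_pow_add_succ i]
    exact ENNReal.tsum_le_tsum fun e => lebesgue_truncation_le (hmono _) _
  · rintro X i hX U ⟨⟨S, hS, hU⟩, hle⟩ hXU
    obtain ⟨c, hc⟩ := Nat.Partrec.Code.exists_code.1 hS
    have hc' : ∀ j σ, σ ∈ S j ↔ p ((Encodable.encode c, j), σ) := fun j σ => by
      simp only [p, Denumerable.ofNat_encode, hc]
      simp [Part.assert]
    refine hX ?_
    have hXj := Set.mem_iInter.1 hXU (i + Encodable.encode c + 1)
    have hlej := hle (i + Encodable.encode c + 1)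
    rw [hU] at hXj hlej
    refine openSet_mono (fun σ (hσ : σ ∈ S (i + Encodable.encode c + 1)) => ?_) hXj
    refine ⟨Encodable.encode c, ?_⟩
    rw [hc', hpg] at hσ
    obtain ⟨n, hn⟩ := hσ
    have hsub : {η | η ∈ g (Encodable.encode c, i + Encodable.encode c + 1) n} ⊆
        S (i + Encodable.encode c + 1) := fun η hη => (hc' _ η).2 ((hpg _ η).2 ⟨n, hη⟩)
    exact ⟨n, hn, (measure_mono (openSet_mono hsub)).trans hlej⟩

/-! ### Clopen approximation of open sets of computable measure -/

/-- If the measures of uniformly effectively open sets are uniformly computable, then these sets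
can be computably approximated in measure by clopen subsets. -/
lemma exists_computable_clopen_approx {α : Type*} [Primcodable α] {p : α × Str → Prop}
    (hp : REPred p) {f : α × ℕ → ℕ × ℕ} (hf : Computable f)
    (hpf : ∀ a i, |lebesgue.real (openSet {σ | p (a, σ)}) - (f (a, i)).1 / 2 ^ (f (a, i)).2| ≤
      (1 / 2 : ℝ) ^ i) :
    ∃ c : α × ℕ → List Str, Computable c ∧ ∀ a i, (∀ σ ∈ c (a, i), p (a, σ)) ∧
      lebesgue (openSet {σ | p (a, σ)}) ≤
        lebesgue (openSet {σ | σ ∈ c (a, i)}) + (2⁻¹ : ℝ≥0∞) ^ i := by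
  classical
  obtain ⟨g, hg, hmono, hpg⟩ := hp.exists_stages
  -- The precision `i + 2` leaves room for the three errors of size `2 ^ (-i-2)` below.
  let P : α × ℕ → ℕ → Prop := fun q s =>
    ((f (q.1, q.2 + 2)).1 : ℝ) / 2 ^ (f (q.1, q.2 + 2)).2 ≤
      lebesgue.real (openSet {σ | σ ∈ g q.1 s}) + 2 / 2 ^ (q.2 + 2)
  have hP : ComputablePred fun q : (α × ℕ) × ℕ => P q.1 q.2 := by
    have hk : Computable fun q : (α × ℕ) × ℕ => q.1.2 + 2 :=
      Computable.succ.comp (Computable.succ.comp (Computable.snd.comp Computable.fst))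
    have hF : Computable fun q : (α × ℕ) × ℕ => f (q.1.1, q.1.2 + 2) :=
      hf.comp ((Computable.fst.comp Computable.fst).pair hk)
    have hG : Computable fun q : (α × ℕ) × ℕ => g q.1.1 q.2 :=
      hg.to_comp.comp (Computable.fst.comp Computable.fst) Computable.snd
    have hQ : Computable fun q : (α × ℕ) × ℕ =>
        (g q.1.1 q.2, (f (q.1.1, q.1.2 + 2)).1, (f (q.1.1, q.1.2 + 2)).2, q.1.2 + 2) :=
      hG.pair ((Computable.fst.comp hF).pair ((Computable.snd.comp hF).pair hk))
    exact primrecPred_le_lebesgue_openSet.computablePred_comp hQ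
  have hunion : ∀ a, openSet {σ | p (a, σ)} = ⋃ s, openSet {σ | σ ∈ g a s} := fun a => by
    rw [← openSet_setOf_exists]
    simp only [hpg]
    rfl
  have hex : ∀ q, ∃ s, P q s := by
    rintro ⟨a, i⟩
    have hlim : Filter.Tendsto (fun s => lebesgue.real (openSet {σ | σ ∈ g a s})) Filter.atTop
        (nhds (lebesgue.real (openSet {σ | p (a, σ)}))) := by
      rw [hunion]
      exact (ENNReal.tendsto_toReal (measure_ne_top _ _)).comp
        (tendsto_measure_iUnion_atTop fun m n hmn => openSet_mono (hmono a m n hmn))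
    have hpos : (0 : ℝ) < (1 / 2) ^ (i + 2) := by positivity
    obtain ⟨s, hs⟩ := (hlim.eventually (lt_mem_nhds (sub_lt_self _ hpos))).exists
    refine ⟨s, ?_⟩
    have h := (abs_le.1 (hpf a (i + 2))).1
    have h2 : (2 : ℝ) / 2 ^ (i + 2) = 2 * (1 / 2) ^ (i + 2) := by
      rw [one_div, inv_pow]; rfl
    simp only [P]
    rw [h2]
    linarith
  refine ⟨fun q => g q.1 (Nat.find (hex q)), ?_, fun a i => ⟨fun σ hσ => (hpg _ _).2 ⟨_, hσ⟩, ?_⟩⟩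
  · exact hg.to_comp.comp Computable.fst (Computable.find hP hex)
  · have hs := Nat.find_spec (hex (a, i))
    set s := Nat.find (hex (a, i))
    have h := (abs_le.1 (hpf a (i + 2))).2
    have h2 : (2 : ℝ) / 2 ^ (i + 2) = 2 * (1 / 2) ^ (i + 2) := by
      rw [one_div, inv_pow]; rfl
    simp only [P] at hs
    rw [h2] at hs
    have hpow : (1 / 2 : ℝ) ^ (i + 2) = (1 / 2) ^ i / 4 := by ring
    have hpos : (0 : ℝ) < (1 / 2) ^ i := by positivity
    have hreal : lebesgue.real (openSet {σ | p (a, σ)}) ≤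
        lebesgue.real (openSet {σ | σ ∈ g a s}) + (1 / 2) ^ i := by
      rw [hpow] at hs h
      linarith
    rw [← ENNReal.toReal_le_toReal (measure_ne_top _ _)
      (ENNReal.add_ne_top.2 ⟨measure_ne_top _ _, by simp⟩),
      ENNReal.toReal_add (measure_ne_top _ _) (by simp)]
    simpa [measureReal_def] using hreal

namespace TuringFunctional

/-! ### Preimages of cylinders under a Turing functional -/

/-- The strings that generate the open set `{X | Φ^X ⪰ τ}`: the inputs on which `Φ` outputs an
extension of `τ`, and all strings if `τ` is empty, since `Φ^X ⪰ []` always holds. -/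
def inputs (Φ : TuringFunctional) (τ : Str) : Set Str :=
  {σ | τ = [] ∨ ∃ τ', (σ, τ') ∈ Φ.graph ∧ τ <+: τ'}

lemma re_inputs (Φ : TuringFunctional) : REPred fun q : Str × Str => q.2 ∈ Φ.inputs q.1 := by
  refine REPred.or (Primrec.eq.comp Primrec.fst (Primrec.const [])).to_re ?_
  refine REPred.exists (p := fun q : (Str × Str) × Str => (q.1.2, q.2) ∈ Φ.graph ∧ q.1.1 <+: q.2)
    (REPred.and ?_ ?_)
  · exact Φ.ce.comp ((Computable.snd.comp Computable.fst).pair Computable.snd)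
  · exact (primrecRel_prefix.comp (Primrec.fst.comp Primrec.fst) Primrec.snd).to_re

lemma openSet_inputs (Φ : TuringFunctional) (τ : Str) :
    openSet (Φ.inputs τ) = {X | Φ.Outputs X τ} := by
  ext X
  simp only [mem_openSet_iff, inputs, Outputs, Set.mem_ofPred_eq]
  constructor
  · rintro ⟨σ, h | ⟨τ', h, hp⟩, hX⟩
    · exact .inl h
    · have hX' : restrict X σ.length = σ := hX
      exact .inr ⟨σ.length, τ', hX'.symm ▸ h, hp⟩
  · rintro (h | ⟨n, τ', h, hp⟩)
    · exact ⟨[], .inl h, rfl⟩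
    · exact ⟨_, .inr ⟨τ', h, hp⟩, mem_cylinder_restrict X n⟩

lemma Outputs.mono {Φ : TuringFunctional} {X : Cantor} {τ τ' : Str} (h : Φ.Outputs X τ')
    (hp : τ <+: τ') : Φ.Outputs X τ := by
  rcases h with rfl | ⟨n, η, h, hp'⟩
  · exact .inl (List.prefix_nil.1 hp)
  · exact .inr ⟨n, η, h, hp.trans hp'⟩

lemma Outputs.prefix_or_prefix {Φ : TuringFunctional} {X : Cantor} {τ τ' : Str}
    (h : Φ.Outputs X τ) (h' : Φ.Outputs X τ') : τ <+: τ' ∨ τ' <+: τ := by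
  rcases h with rfl | ⟨n, η, h, hp⟩
  · exact .inl List.nil_prefix
  rcases h' with rfl | ⟨n', η', h', hp'⟩
  · exact .inr List.nil_prefix
  have hc : η <+: η' ∨ η' <+: η := by
    rcases le_total n n' with hn | hn
    · exact Φ.consistent _ _ _ _ h h' (restrict_prefix_restrict X hn)
    · exact (Φ.consistent _ _ _ _ h' h (restrict_prefix_restrict X hn)).symm
  rcases hc with hc | hc
  · exact List.prefix_or_prefix_of_prefix (hp.trans hc) hp'
  · exact List.prefix_or_prefix_of_prefix hp (hp'.trans hc)

/-- The measure of the preimage of an open set is the sum of the values of the semi-measure on the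
minimal strings that generate the open set; consistency makes the summands disjoint. -/
lemma lebesgue_biUnion_outputs (Φ : TuringFunctional) (W : Set Str) :
    lebesgue (⋃ τ ∈ W, {X | Φ.Outputs X τ}) =
      ∑' τ : {τ ∈ W | ∀ τ' ∈ W, τ' <+: τ → τ' = τ}, ENNReal.ofReal (Φ.semimeasure τ) := by
  have h : ⋃ τ ∈ W, {X | Φ.Outputs X τ} =
      ⋃ τ ∈ {τ ∈ W | ∀ τ' ∈ W, τ' <+: τ → τ' = τ}, {X | Φ.Outputs X τ} := by
    refine Set.Subset.antisymm (Set.iUnion₂_subset fun τ hτ X hX => ?_)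
      (Set.biUnion_subset_biUnion_left fun τ hτ => hτ.1)
    -- The shortest element of `W` that is output on `X` is minimal.
    have hex : ∃ n, ∃ η ∈ W, η.length = n ∧ Φ.Outputs X η := ⟨_, τ, hτ, rfl, hX⟩
    classical
    obtain ⟨η, hη, hl, hXη⟩ := Nat.find_spec hex
    refine Set.mem_biUnion (x := η) ⟨hη, fun τ' hτ' hp => ?_⟩ hXη
    exact hp.eq_of_length_le (hl ▸ Nat.find_min' hex ⟨τ', hτ', rfl, hXη.mono hp⟩)
  rw [h, measure_biUnion (Set.to_countable _)]
  · refine tsum_congr fun τ => ?_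
    rw [semimeasure, ENNReal.ofReal_toReal (measure_ne_top _ _)]
  · intro τ hτ τ' hτ' hne
    refine Set.disjoint_left.2 fun X hX hX' => hne ?_
    rcases Outputs.prefix_or_prefix hX hX' with hp | hp
    · exact hτ'.2 τ hτ.1 hp
    · exact (hτ.2 τ' hτ'.1 hp).symm
  · intro τ _
    rw [← openSet_inputs]
    exact measurableSet_openSet _

/-! ### The complement of the image of the random sequences -/

/-- For a computable induced semi-measure, the sequences outside `Ψ(MLR)` form an effectively
null set: they lie in uniformly effectively open sets whose preimages under `Ψ` have small
measure. -/
lemma exists_ce_cover_compl_image (Ψ : TuringFunctional) (h : IsComputableReal Ψ.semimeasure) :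
    ∃ W : ℕ → Set Str, UniformlyCE W ∧
      (∀ i, lebesgue (⋃ τ ∈ W i, {X | Ψ.Outputs X τ}) ≤ (2⁻¹ : ℝ≥0∞) ^ i) ∧
      ∀ Y ∉ Ψ.image MLR, ∀ i, ∃ n, restrict Y n ∈ W i := by
  obtain ⟨S, hS, hSle, hSMLR⟩ := exists_universal_test
  obtain ⟨f, hf, hlf⟩ := h
  obtain ⟨c₀, hc₀, hc₀'⟩ := exists_computable_clopen_approx Ψ.re_inputs hf fun τ i => by
    have := hlf τ i
    rw [semimeasure, ← openSet_inputs] at this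
    exact this
  -- `c i τ` approximates the preimage of `τ`, with errors of total size `2 ^ (-i-1)`.
  let c : ℕ → Str → List Str := fun i τ => c₀ (τ, i + 1 + Encodable.encode τ + 1)
  have hc : Computable fun q : ℕ × Str => c q.1 q.2 := by
    refine hc₀.comp (Computable.snd.pair (Primrec.to_comp ?_))
    exact Primrec.succ.comp (Primrec.nat_add.comp (Primrec.succ.comp Primrec.fst)
      (Primrec.encode.comp Primrec.snd))
  have hcsub : ∀ i τ, openSet {σ | σ ∈ c i τ} ⊆ openSet (Ψ.inputs τ) := fun i τ =>
    openSet_mono fun σ hσ => (hc₀' τ _).1 σ hσ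
  let D : ℕ → Str → Set Str := fun i τ =>
    {ρ | (∃ σ ∈ Ψ.inputs τ, σ <+: ρ) ∧ ∀ η ∈ c i τ, ¬ (η <+: ρ ∨ ρ <+: η)}
  have hD : ∀ i τ, openSet (D i τ) = openSet (Ψ.inputs τ) \ openSet {σ | σ ∈ c i τ} := fun i τ =>
    openSet_diff_list _ _
  let T : ℕ → Set Str := fun i => {ρ | ρ ∈ S (i + 1) ∨ ρ ∈ {ρ | ∃ τ, ρ ∈ D i τ}}
  have hTopen : ∀ i, openSet (T i) = openSet (S (i + 1)) ∪ ⋃ τ, openSet (D i τ) := fun i => by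
    rw [← openSet_setOf_exists]
    exact Set.biUnion_union _ _ _
  have hDle : ∀ i τ, lebesgue (openSet (D i τ)) ≤
      (2⁻¹ : ℝ≥0∞) ^ (i + 1 + Encodable.encode τ + 1) := fun i τ => by
    rw [hD, measure_sdiff (hcsub i τ) (measurableSet_openSet _).nullMeasurableSet
      (measure_ne_top _ _), tsub_le_iff_left]
    exact (hc₀' τ _).2
  have hTle : ∀ i, lebesgue (openSet (T i)) ≤ (2⁻¹ : ℝ≥0∞) ^ i := fun i => by
    have h1 : lebesgue (⋃ τ, openSet (D i τ)) ≤ (2⁻¹ : ℝ≥0∞) ^ (i + 1) := by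
      refine (measure_iUnion_le _).trans ((ENNReal.tsum_le_tsum (hDle i)).trans ?_)
      rw [← tsum_inv_two_pow_add_succ (i + 1)]
      exact ENNReal.tsum_comp_le_tsum_of_injective Encodable.encode_injective
        fun e => (2⁻¹ : ℝ≥0∞) ^ (i + 1 + e + 1)
    rw [hTopen]
    refine (measure_union_le _ _).trans ((add_le_add (hSle _) h1).trans_eq ?_)
    rw [pow_succ, ← mul_add, ENNReal.inv_two_add_inv_two, mul_one]
  -- Off `openSet (T i)`, the preimage of `τ` agrees with the clopen set given by `c i τ`.
  have hinputs : ∀ i τ, openSet (Ψ.inputs τ) ⊆ openSet {σ | σ ∈ c i τ} ∪ openSet (T i) := by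
    intro i τ X hX
    by_cases hXc : X ∈ openSet {σ | σ ∈ c i τ}
    · exact .inl hXc
    · rw [hTopen]
      exact .inr (.inr (Set.mem_iUnion.2 ⟨τ, (hD i τ).symm ▸ ⟨hX, hXc⟩⟩))
  let W : ℕ → Set Str := fun i =>
    {τ | ∃ m, ∀ ρ ∈ strs m, (∃ σ ∈ c i τ, σ <+: ρ ∨ ρ <+: σ) → ∃ σ ∈ T i, σ <+: ρ}
  refine ⟨W, ?_, fun i => ?_, fun Y hY i => ?_⟩
  · have hT : REPred fun q : ℕ × Str => q.2 ∈ T q.1 := by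
      refine REPred.or (hS.comp (f := fun q : ℕ × Str => (q.1 + 1, q.2))
        ((Primrec.succ.comp Primrec.fst).pair Primrec.snd).to_comp) ?_
      refine REPred.exists (p := fun q : (ℕ × Str) × Str => q.1.2 ∈ D q.1.1 q.2) (REPred.and ?_ ?_)
      · refine REPred.exists (p := fun q : ((ℕ × Str) × Str) × Str =>
          q.2 ∈ Ψ.inputs q.1.2 ∧ q.2 <+: q.1.1.2) (REPred.and ?_ ?_)
        · exact Ψ.re_inputs.comp (f := fun q : ((ℕ × Str) × Str) × Str => (q.1.2, q.2))
            ((Primrec.snd.comp Primrec.fst).pair Primrec.snd).to_comp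
        · exact (primrecRel_prefix.comp Primrec.snd
            (Primrec.snd.comp (Primrec.fst.comp Primrec.fst))).to_re
      · have h1 : PrimrecRel fun (L : List Str) (ρ : Str) => ∀ η ∈ L, ¬ (η <+: ρ ∨ ρ <+: η) :=
          PrimrecRel.forall_mem_list (PrimrecPred.not primrecRel_compatible)
        refine REPred.comp h1.to_re (f := fun q : (ℕ × Str) × Str => (c q.1.1 q.2, q.1.2)) ?_
        exact (hc.comp ((Computable.fst.comp Computable.fst).pair Computable.snd)).pair
          (Computable.snd.comp Computable.fst)
    -- The implication is a disjunction of a decidable and a recursively enumerable predicate.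
    have hmatrix : REPred fun q : (ℕ × Str) × Str =>
        (¬ ∃ σ ∈ c q.1.1 q.1.2, σ <+: q.2 ∨ q.2 <+: σ) ∨ ∃ σ, σ ∈ T q.1.1 ∧ σ <+: q.2 := by
      refine REPred.or ?_ ?_
      · have h1 : PrimrecRel fun (L : List Str) (ρ : Str) => ∃ σ ∈ L, σ <+: ρ ∨ ρ <+: σ :=
          PrimrecRel.exists_mem_list primrecRel_compatible
        exact REPred.comp (PrimrecPred.not h1).to_re
          (f := fun q : (ℕ × Str) × Str => (c q.1.1 q.1.2, q.2))
          ((hc.comp Computable.fst).pair Computable.snd)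
      · refine REPred.exists (p := fun q : ((ℕ × Str) × Str) × Str =>
          q.2 ∈ T q.1.1.1 ∧ q.2 <+: q.1.2) (REPred.and ?_ ?_)
        · exact hT.comp (f := fun q : ((ℕ × Str) × Str) × Str => (q.1.1.1, q.2))
            ((Primrec.fst.comp (Primrec.fst.comp Primrec.fst)).pair Primrec.snd).to_comp
        · exact (primrecRel_prefix.comp Primrec.snd (Primrec.snd.comp Primrec.fst)).to_re
    have hall := hmatrix.forall_mem_list.comp (f := fun q : (ℕ × Str) × ℕ => (q.1, strs q.2))
      (Primrec.fst.pair (primrec_strs.comp Primrec.snd)).to_comp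
    refine hall.exists.of_eq fun q => ?_
    simp only [W, Set.mem_ofPred_eq, imp_iff_not_or]
  · refine (measure_mono (Set.iUnion₂_subset fun τ hτ => ?_)).trans (hTle i)
    obtain ⟨m, hm⟩ := hτ
    rw [← openSet_inputs]
    exact (hinputs i τ).trans (Set.union_subset (openSet_subset_of_forall_strs hm) subset_rfl)
  · by_contra! hn
    refine hY ?_
    -- On the closed complement of `openSet (T i)`, the preimages of the initial segments of `Y`
    -- are clopen, so that a random sequence in all of them is found by compactness.
    let K : ℕ → Set Cantor := fun n => openSet {σ | σ ∈ c i (restrict Y n)} \ openSet (T i)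
    have hKclosed : ∀ n, IsClosed (K n) := fun n =>
      (isClosed_openSet_list _).sdiff (isOpen_openSet _)
    have hKne : ∀ n, (K n).Nonempty := fun n => by
      rw [Set.sdiff_nonempty]
      exact fun hsub => hn n (exists_forall_strs_of_openSet_subset hsub)
    have hKanti : ∀ n, K (n + 1) ⊆ K n := fun n X ⟨hX, hXT⟩ => by
      refine ⟨(hinputs i _ ?_).resolve_right hXT, hXT⟩
      have h1 := hcsub i _ hX
      rw [openSet_inputs] at h1 ⊢
      exact Outputs.mono h1 (restrict_prefix_restrict Y n.le_succ)
    obtain ⟨X, hX⟩ := IsCompact.nonempty_iInter_of_sequence_nonempty_isCompact_isClosed K hKanti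
      hKne (hKclosed 0).isCompact hKclosed
    rw [Set.mem_iInter] at hX
    refine ⟨X, hSMLR X (i + 1) fun hXS => (hX 0).2 ?_, fun n => ?_⟩
    · rw [hTopen]
      exact .inl hXS
    · have h1 := hcsub i _ (hX n).1
      rw [openSet_inputs] at h1
      exact h1

lemma image_MLR_subset {Φ Ψ : TuringFunctional} (hΦΨ : Φ.semimeasure = Ψ.semimeasure)
    (h : IsComputableReal Ψ.semimeasure) : Φ.image MLR ⊆ Ψ.image MLR := by
  rintro Y ⟨X, hX, hXY⟩
  by_contra hY
  obtain ⟨W, hW, hWle, hYW⟩ := Ψ.exists_ce_cover_compl_image h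
  have hopen : ∀ i, openSet {σ | ∃ τ, τ ∈ W i ∧ σ ∈ Φ.inputs τ} =
      ⋃ τ ∈ W i, {X | Φ.Outputs X τ} := fun i => by
    ext X
    simp only [← openSet_inputs, mem_openSet_iff, Set.mem_ofPred_eq, Set.mem_iUnion, exists_prop]
    exact ⟨fun ⟨σ, ⟨τ, h1, h2⟩, h3⟩ => ⟨τ, h1, σ, h2, h3⟩,
      fun ⟨τ, h1, σ, h2, h3⟩ => ⟨σ, ⟨τ, h1, h2⟩, h3⟩⟩
  refine hX (fun i => ⋃ τ ∈ W i, {X | Φ.Outputs X τ}) ⟨⟨_, ?_, fun i => (hopen i).symm⟩,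
    fun i => ?_⟩ (Set.mem_iInter.2 fun i => ?_)
  · refine REPred.exists (p := fun q : (ℕ × Str) × Str =>
      q.2 ∈ W q.1.1 ∧ q.1.2 ∈ Φ.inputs q.2) (REPred.and ?_ ?_)
    · exact hW.comp (f := fun q : (ℕ × Str) × Str => (q.1.1, q.2))
        ((Primrec.fst.comp Primrec.fst).pair Primrec.snd).to_comp
    · exact Φ.re_inputs.comp (f := fun q : (ℕ × Str) × Str => (q.2, q.1.2))
        (Primrec.snd.pair (Primrec.snd.comp Primrec.fst)).to_comp
  · have := hWle i
    rwa [lebesgue_biUnion_outputs, ← hΦΨ, ← lebesgue_biUnion_outputs] at this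
  · obtain ⟨n, hn⟩ := hYW Y hY i
    exact Set.mem_biUnion hn (hXY n)

end TuringFunctional

end CantorRandomness

theorem theorem3p1 (Φ Ψ : CantorRandomness.TuringFunctional)
    (hΦΨ : Φ.semimeasure = Ψ.semimeasure)
    (hcomp : CantorRandomness.IsComputableReal Φ.semimeasure) :
    Φ.image CantorRandomness.MLR = Ψ.image CantorRandomness.MLR :=
  (CantorRandomness.TuringFunctional.image_MLR_subset hΦΨ (hΦΨ ▸ hcomp)).antisymm
    (CantorRandomness.TuringFunctional.image_MLR_subset hΦΨ.symm hcomp)
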